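/- Let $\mathbb K$ be $\mathbb R$ or $\mathbb C$, let $X$ be a Banach space over $\mathbb K$ with closed unit ball $B_X$, and let $K\subset X^*$ be weak$^*$-compact. *Summable Szlenk index.* For $L\subset X^*$ and $\varepsilon>0$ let $s_\varepsilon(L)$ be the set of those $x^*\in L$ such that every weak$^*$-neighborhood $V$ of $x^*$ satisfies $\operatorname{diam}(V\cap L)>\varepsilon$ (norm diameter); for $\varepsilon\le 0$ let $s_\varepsilon(L)=L$. A set $L$ has *summable Szlenk index* if there is $M\ge 0$ such that $\sum_{i=1}^n\varepsilon_i\le M$ whenever $\varepsilon_1,\dots,\varepsilon_n\in\mathbb R$ are such that $s_{\varepsilon_1}\cdots s_{\varepsilon_n}(L)\neq\varnothing$. *The quantity $\Sigma(K)$.* For a nonempty directed set $D$ and $n\ge 1$ let $D^{\le n}=\bigcup_{i=1}^n D^i$, and for $t=(u_1,\dots,u_n)\in D^n$ write $t|_i=(u_1,\dots,u_i)$. A collection $(x_t)_{t\in D^{\le n}}\subset X$ is *weakly null* if for every $t$ that is the empty sequence or belongs to $D^{\le n-1}$, the net $(x_{t\smallfrown u})_{u\in D}$ is weakly null, where $t\smallfrown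 u$ is $t$ with $u$ appended. Let $r_K(x)=\max_{x^*\in K}\operatorname{Re}x^*(x)$ if $K\ne\varnothing$, and $r_K(x)=0$ if $K=\varnothing$. Let $\Sigma_n(K)$ be the infimum of those $s>0$ such that for every directed set $D$ and every weakly null $(x_t)_{t\in D^{\le n}}\subset B_X$, $$\inf_{t\in D^n} r_K\Bigl(\sum_{i=1}^n x_{t|_i}\Bigr)\le s,$$ and let $\Sigma(K)=\sup_{n\ge 1}\Sigma_n(K)\in[0,\infty]$. Then the following three conditions are equivalent: 1. $K$ has summable Szlenk index; 2. $\Sigma(K)<\infty$; 3. the weak$^*$-closed absolutely convex hull $\overline{\operatorname{abs\,co}}^{\,\mathrm{weak}^*}(K)$ has summable Szlenk index. -/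

import Mathlib

open Filter Topology

universe u v w

noncomputable section

section Szlenk

variable {𝕜 : Type w} [RCLike 𝕜] {X : Type u} [NormedAddCommGroup X] [NormedSpace 𝕜 X]

/-- The Szlenk derivation `s_ε(K)`: all `f ∈ K` such that every weak*-neighbourhood `V` of `f`
satisfies `diam (V ∩ K) > ε`, the diameter being that of the dual norm; and `s_ε(K) = K` for
`ε ≤ 0`. -/
def szlenkDeriv (ε : ℝ) (K : Set (WeakDual 𝕜 X)) : Set (WeakDual 𝕜 X) :=
  {f | f ∈ K ∧ (0 < ε → ∀ V ∈ 𝓝 f,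
    ENNReal.ofReal ε < Metric.ediam (WeakDual.toStrongDual '' (V ∩ K)))}

/-- The iterated derivation: for `l = [ε₁, …, εₙ]` this is `s_{ε₁} (⋯ (s_{εₙ} (K)))`. -/
def szlenkDerivList (l : List ℝ) (K : Set (WeakDual 𝕜 X)) : Set (WeakDual 𝕜 X) :=
  l.foldr szlenkDeriv K

/-- `K` has `M`-summable Szlenk index. -/
def HasSummableSzlenkIndexWith (M : ℝ) (K : Set (WeakDual 𝕜 X)) : Prop :=
  ∀ l : List ℝ, (szlenkDerivList l K).Nonempty → l.sum ≤ M

/-- `K` has summable Szlenk index. -/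
def HasSummableSzlenkIndex (K : Set (WeakDual 𝕜 X)) : Prop :=
  ∃ M : ℝ, 0 ≤ M ∧ HasSummableSzlenkIndexWith M K

/-- `r_K(x) = max_{f ∈ K} Re f(x)`, and `r_K(x) = 0` if `K` is empty (`sSup ∅ = 0` in `ℝ`). -/
def supportFun (K : Set (WeakDual 𝕜 X)) (x : X) : ℝ :=
  sSup ((fun f : WeakDual 𝕜 X => RCLike.re (f x)) '' K)

/-- A collection `(x_t)`, `t ∈ D^{≤ n} = D¹ ∪ ⋯ ∪ Dⁿ`, of vectors in the closed unit ball of `X`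
which is weakly null: for every `t` of length `0 ≤ |t| < n` the net `(x_{t⌢u})_{u ∈ D}` is weakly
null. Sequences are lists; the values of `x` at lists of length `0` or `> n` play no role. -/
structure IsWeaklyNullTree (𝕜 : Type w) [RCLike 𝕜] {X : Type u} [NormedAddCommGroup X]
    [NormedSpace 𝕜 X] {D : Type v} [Preorder D] (n : ℕ) (x : List D → X) : Prop where
  norm_le_one : ∀ t : List D, 1 ≤ t.length → t.length ≤ n → ‖x t‖ ≤ 1
  weakly_null : ∀ t : List D, t.length < n → ∀ f : StrongDual 𝕜 X,
    Tendsto (fun u : D => f (x (t ++ [u]))) atTop (𝓝 0)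

/-- The sum `x_{t|₁} + ⋯ + x_{t|ₙ}` along the branch of `t ∈ Dⁿ`. -/
def branchSum {X : Type u} [AddCommMonoid X] {D : Type v} {n : ℕ} (x : List D → X)
    (t : Fin n → D) : X :=
  ∑ i ∈ Finset.Icc 1 n, x ((List.ofFn t).take i)

/-- For every (nonempty) directed set `D` and every weakly null `(x_t)_{t ∈ D^{≤ n}}` in the unit
ball, `inf_{t ∈ Dⁿ} r_K(x_{t|₁} + ⋯ + x_{t|ₙ}) ≤ s`. The directed sets range over a universe which
contains the subsets of `X`, and which is otherwise arbitrary. -/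
def TreeBound (n : ℕ) (K : Set (WeakDual 𝕜 X)) (s : ℝ) : Prop :=
  ∀ (D : Type (max u v)) [Preorder D] [IsDirectedOrder D] [Nonempty D] (x : List D → X),
    IsWeaklyNullTree 𝕜 n x → ⨅ t : Fin n → D, supportFun K (branchSum x t) ≤ s

/-- `Σₙ(K)`, the infimum of the `s > 0` which bound all weakly null trees of height `n`. -/
def szlenkSigmaN (n : ℕ) (K : Set (WeakDual 𝕜 X)) : ENNReal :=
  sInf {a | ∃ s : ℝ, 0 < s ∧ TreeBound.{u, v} n K s ∧ a = ENNReal.ofReal s}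

/-- `Σ(K) = sup_{n ≥ 1} Σₙ(K) ∈ [0, ∞]`. -/
def szlenkSigma (K : Set (WeakDual 𝕜 X)) : ENNReal :=
  ⨆ (n : ℕ) (_ : 1 ≤ n), szlenkSigmaN.{u, v} n K

open scoped ComplexOrder in
/-- The weak*-closed absolutely convex hull. The order on `𝕜` which `AbsConvex` refers to is the
one for which `0 ≤ a` means that `a` is a nonnegative real number. -/
def weakStarClosedAbsConvexHull (K : Set (WeakDual 𝕜 X)) : Set (WeakDual 𝕜 X) :=
  closedAbsConvexHull 𝕜 K

end Szlenk

end

/-! ### Iterated filter quantifiers along branches. -/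

section EventualTrees

variable {α : Type*}

/-! All three conditions are compared with one statement free of directed sets: for some `s` and all
`n ≥ 1`, `r_K(x₁ + ⋯ + xₙ) ≤ s` for almost all `x₁`, …, almost all `xₙ`, where "almost all" refers
to weak neighbourhoods of `0` in the ball. Trees indexed by the filter itself show that this is
finiteness of `Σ(K)` (`EventuallyTree.treeBound`, `TreeBound.eventuallyTree`).

If `K` has summable index, functionals large on many branches have weak*-cluster points in iterated
derived sets, with `εᵢ` close to the values on `xᵢ` (`exists_mem_szlenkDerivList_of_frequently`); so
the bound holds.

Conversely, unlike the index, the bound passes easily to the hull: almost-all statements can be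
rotated and intersected, giving `|f(x₁ + ⋯ + xₙ)| ≤ 2s` on `K`, hence on the hull. A point of an
iterated derived set of the hull would produce branches with values near `∑ εᵢ / 4`
(`not_eventuallyTree_of_mem_szlenkDerivList`), so `∑ εᵢ ≤ 8s`. Monotonicity returns from the hull to
`K`. -/

/-- `EventuallyTree F n P` means that `P [x₁, …, xₙ]` holds for `F`-almost all `x₁`, …,
for `F`-almost all `xₙ`. -/
def EventuallyTree (F : Filter α) : ℕ → (List α → Prop) → Prop
  | 0, P => P []
  | n + 1, P => ∀ᶠ x in F, EventuallyTree F n fun l => P (x :: l)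

theorem EventuallyTree.mono {F : Filter α} {n : ℕ} {P Q : List α → Prop}
    (h : EventuallyTree F n P) (hPQ : ∀ l, P l → Q l) : EventuallyTree F n Q := by
  induction n generalizing P Q with
  | zero => exact hPQ _ h
  | succ n ih => exact Eventually.mono h fun x hx => ih hx fun l => hPQ _

theorem EventuallyTree.and {F : Filter α} {n : ℕ} {P Q : List α → Prop}
    (hP : EventuallyTree F n P) (hQ : EventuallyTree F n Q) :
    EventuallyTree F n fun l => P l ∧ Q l := by
  induction n generalizing P Q with
  | zero => exact ⟨hP, hQ⟩
  | succ n ih => exact (Eventually.and hP hQ).mono fun x hx => ih hx.1 hx.2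

theorem EventuallyTree.map {F : Filter α} {φ : α → α} (hφ : Tendsto φ F F) {n : ℕ}
    {P : List α → Prop} (hP : EventuallyTree F n P) :
    EventuallyTree F n fun l => P (l.map φ) := by
  induction n generalizing P with
  | zero => exact hP
  | succ n ih => exact (hφ.eventually hP).mono fun x hx => ih hx

/-- The values of `x` at the nonempty initial segments of a list. -/
def branchValues {D : Type*} : (List D → α) → List D → List α
  | _, [] => []
  | x, u :: t => x [u] :: branchValues (fun s => x (u :: s)) t

theorem sum_branchValues [AddCommMonoid α] {D : Type*} (x : List D → α) (t : List D) :
    (branchValues x t).sum = ∑ i ∈ Finset.Icc 1 t.length, x (t.take i) := by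
  induction t generalizing x with
  | nil => simp [branchValues]
  | cons u t ih =>
    rw [branchValues, List.sum_cons, ih, List.length_cons,
      ← Finset.add_sum_Ioc_eq_sum_Icc (by omega : 1 ≤ t.length + 1)]
    congr 1
    rw [← Finset.Icc_add_one_left_eq_Ioc, ← Finset.image_add_right_Icc, Finset.sum_image (by simp)]
    simp

theorem branchSum_eq_sum_branchValues [AddCommMonoid α] {D : Type*} {n : ℕ} (x : List D → α)
    (t : Fin n → D) : branchSum x t = (branchValues x (List.ofFn t)).sum := by
  rw [sum_branchValues, List.length_ofFn, branchSum]

end EventualTrees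

/-! ### Weak neighbourhoods of zero in the unit ball. -/

section WeakFilter

variable (𝕜 : Type w) [RCLike 𝕜] (X : Type u) [NormedAddCommGroup X] [NormedSpace 𝕜 X]

/-- The trace on the closed unit ball of the filter of weak neighbourhoods of `0`. -/
def weakBallFilter : Filter X :=
  (⨅ f : StrongDual 𝕜 X, comap f (𝓝 0)) ⊓ 𝓟 (Metric.closedBall 0 1)

variable {𝕜 X}

theorem tendsto_weakBallFilter_iff {ι : Type*} {l : Filter ι} {φ : ι → X} :
    Tendsto φ l (weakBallFilter 𝕜 X) ↔
      (∀ f : StrongDual 𝕜 X, Tendsto (fun i => f (φ i)) l (𝓝 0)) ∧ ∀ᶠ i in l, ‖φ i‖ ≤ 1 := by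
  simp [weakBallFilter, tendsto_inf, tendsto_iInf, tendsto_comap_iff, Function.comp_def]

theorem tendsto_apply_weakBallFilter (f : StrongDual 𝕜 X) :
    Tendsto f (weakBallFilter 𝕜 X) (𝓝 0) :=
  (tendsto_weakBallFilter_iff.1 (tendsto_id (x := weakBallFilter 𝕜 X))).1 f

theorem eventually_norm_le_weakBallFilter : ∀ᶠ x in weakBallFilter 𝕜 X, ‖x‖ ≤ 1 :=
  (tendsto_weakBallFilter_iff.1 (tendsto_id (x := weakBallFilter 𝕜 X))).2

theorem tendsto_smul_weakBallFilter {c : 𝕜} (hc : ‖c‖ ≤ 1) :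
    Tendsto (fun x : X => c • x) (weakBallFilter 𝕜 X) (weakBallFilter 𝕜 X) := by
  refine tendsto_weakBallFilter_iff.2 ⟨fun f => ?_, ?_⟩
  · simpa using (tendsto_apply_weakBallFilter f).const_mul c
  · filter_upwards [eventually_norm_le_weakBallFilter (𝕜 := 𝕜)] with x hx
    rw [norm_smul]
    exact mul_le_one₀ hc (norm_nonneg _) hx

theorem zero_mem_of_mem_weakBallFilter {U : Set X} (hU : U ∈ weakBallFilter 𝕜 X) :
    (0 : X) ∈ U := by
  have : Tendsto (fun _ : Unit => (0 : X)) ⊤ (weakBallFilter 𝕜 X) :=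
    tendsto_weakBallFilter_iff.2 ⟨fun f => by simp, by simp⟩
  simpa using this hU

/-- The unit ball is precompact in the weak topology. -/
theorem exists_finite_half_sub_mem {U : Set X} (hU : U ∈ weakBallFilter 𝕜 X) :
    ∃ A : Set X, A.Finite ∧ ∀ x : X, ‖x‖ ≤ 1 → ∃ a ∈ A, (2⁻¹ : 𝕜) • (x - a) ∈ U := by
  rw [weakBallFilter, mem_inf_principal, (HasBasis.iInf fun f : StrongDual 𝕜 X =>
    Metric.nhds_basis_ball.comap f).mem_iff] at hU
  obtain ⟨⟨I, r⟩, ⟨hI, hr⟩, hIU⟩ := hU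
  have := hI.fintype
  let Φ : X →L[𝕜] (I → 𝕜) := ContinuousLinearMap.pi fun i => i.1
  have hev : ∀ᶠ δ in 𝓝[>] (0 : ℝ), 0 < δ ∧ ∀ i : I, δ < r i :=
    (eventually_mem_nhdsWithin).and <| eventually_all.2 fun i =>
      eventually_nhdsWithin_of_eventually_nhds (eventually_lt_nhds (hr i))
  obtain ⟨δ, hδ, hδr⟩ := hev.exists
  have hb : TotallyBounded (Φ '' Metric.closedBall 0 1) :=
    (Φ.lipschitz.isBounded_image
      Metric.isBounded_closedBall).isCompact_closure.totallyBounded.subset subset_closure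
  -- The net is taken inside the image of the ball, so its points lift to vectors `a` of norm at
  -- most `1`; the factor `1/2` then keeps `(x - a)/2` in the ball.
  obtain ⟨A, hA, hAf, hcov⟩ := Set.exists_subset_image_finite_and.1
    (Metric.finite_approx_of_totallyBounded hb δ hδ)
  refine ⟨A, hAf, fun x hx => ?_⟩
  obtain ⟨b, hb, hxb⟩ := Set.mem_iUnion₂.1 (hcov ⟨x, by simpa using hx, rfl⟩)
  obtain ⟨a, ha, rfl⟩ := hb
  have ha1 : ‖a‖ ≤ 1 := by simpa using hA ha
  refine ⟨a, ha, hIU ?_ ?_⟩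
  · refine Set.mem_iInter.2 fun i => ?_
    have h1 : dist (Φ x i) (Φ a i) < r i :=
      ((dist_le_pi_dist _ _ i).trans_lt hxb).trans (hδr i)
    rw [dist_eq_norm] at h1
    have h2 : ‖i.1 x - i.1 a‖ < r i := h1
    simp only [Set.mem_preimage, mem_ball_zero_iff, map_smul, map_sub, norm_smul]
    have := norm_nonneg (i.1 x - i.1 a)
    norm_num
    linarith
  · have := norm_sub_le x a
    simp only [mem_closedBall_zero_iff, norm_smul]
    norm_num
    linarith

end WeakFilter

/-! ### Derived sets and support functions. -/

section Szlenk

variable {𝕜 : Type w} [RCLike 𝕜] {X : Type u} [NormedAddCommGroup X] [NormedSpace 𝕜 X]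

theorem szlenkDeriv_subset (ε : ℝ) (K : Set (WeakDual 𝕜 X)) : szlenkDeriv ε K ⊆ K :=
  fun _ hf => hf.1

theorem szlenkDeriv_mono (ε : ℝ) {K L : Set (WeakDual 𝕜 X)} (h : K ⊆ L) :
    szlenkDeriv ε K ⊆ szlenkDeriv ε L := fun _ hf =>
  ⟨h hf.1, fun hε V hV => (hf.2 hε V hV).trans_le
    (Metric.ediam_mono (Set.image_mono (Set.inter_subset_inter_right V h)))⟩

theorem szlenkDerivList_mono (l : List ℝ) {K L : Set (WeakDual 𝕜 X)} (h : K ⊆ L) :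
    szlenkDerivList l K ⊆ szlenkDerivList l L := by
  induction l with
  | nil => exact h
  | cons ε l ih => exact szlenkDeriv_mono ε ih

theorem szlenkDerivList_subset (l : List ℝ) (K : Set (WeakDual 𝕜 X)) :
    szlenkDerivList l K ⊆ K := by
  induction l with
  | nil => exact subset_rfl
  | cons ε l ih => exact (szlenkDeriv_subset ε _).trans ih

theorem HasSummableSzlenkIndex.mono {K L : Set (WeakDual 𝕜 X)} (hL : HasSummableSzlenkIndex L)
    (h : K ⊆ L) : HasSummableSzlenkIndex K :=
  hL.imp fun _ hM => ⟨hM.1, fun l hl => hM.2 l (hl.mono (szlenkDerivList_mono l h))⟩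

/-- An open neighbourhood of a limit point is also a neighbourhood of some point of the derived set.
Derived sets of compact sets thus stay compact, and cluster points can be taken repeatedly. -/
theorem IsClosed.szlenkDeriv {K : Set (WeakDual 𝕜 X)} (hK : IsClosed K) (ε : ℝ) :
    IsClosed (szlenkDeriv ε K) := by
  refine isClosed_of_closure_subset fun f hf => ⟨?_, fun hε V hV => ?_⟩
  · exact hK.closure_subset (closure_mono (szlenkDeriv_subset ε K) hf)
  · obtain ⟨W, hWV, hW, hfW⟩ := mem_nhds_iff.1 hV
    obtain ⟨g, hgW, hg⟩ := mem_closure_iff.1 hf W hW hfW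
    exact hg.2 hε V (mem_of_superset (hW.mem_nhds hgW) hWV)

theorem IsClosed.szlenkDerivList {K : Set (WeakDual 𝕜 X)} (hK : IsClosed K) (l : List ℝ) :
    IsClosed (szlenkDerivList l K) := by
  induction l with
  | nil => exact hK
  | cons ε l ih => exact ih.szlenkDeriv ε

/-- Uniform boundedness; completeness of `X` enters the proof only here. -/
theorem exists_norm_apply_le_of_isCompact [CompleteSpace X] {K : Set (WeakDual 𝕜 X)}
    (hK : IsCompact K) : ∃ R : ℝ, 0 ≤ R ∧ ∀ f ∈ K, ∀ x : X, ‖f x‖ ≤ R * ‖x‖ := by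
  obtain ⟨R, hR⟩ := banach_steinhaus (g := fun f : K => WeakDual.toStrongDual f.1) fun x => by
    obtain ⟨C, hC⟩ := hK.exists_bound_of_continuousOn (WeakDual.eval_continuous x).continuousOn
    exact ⟨C, fun f => hC f f.2⟩
  exact ⟨max R 0, le_max_right _ _, fun f hf x =>
    (WeakDual.toStrongDual f).le_of_opNorm_le ((hR ⟨f, hf⟩).trans (le_max_left _ _)) x⟩

theorem bddAbove_re_apply {K : Set (WeakDual 𝕜 X)} (hK : IsCompact K) (x : X) :
    BddAbove ((fun f : WeakDual 𝕜 X => RCLike.re (f x)) '' K) :=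
  hK.bddAbove_image (RCLike.continuous_re.comp (WeakDual.eval_continuous x)).continuousOn

theorem re_apply_le_supportFun {K : Set (WeakDual 𝕜 X)} (hK : IsCompact K) {f : WeakDual 𝕜 X}
    (hf : f ∈ K) (x : X) : RCLike.re (f x) ≤ supportFun K x :=
  le_csSup (bddAbove_re_apply hK x) ⟨f, hf, rfl⟩

theorem supportFun_le {K : Set (WeakDual 𝕜 X)} {x : X} {c : ℝ} (hc : 0 ≤ c)
    (h : ∀ f ∈ K, RCLike.re (f x) ≤ c) : supportFun K x ≤ c :=
  Real.sSup_le (by rintro _ ⟨f, hf, rfl⟩; exact h f hf) hc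

/-! ### From large branches to derived sets. -/

/-- Weak*-limits of functionals in `K` which are large on a weakly null family of vectors belong
to the derived set of `K`. -/
theorem exists_mem_szlenkDeriv_of_frequently {K : Set (WeakDual 𝕜 X)} (hK : IsCompact K)
    {y : X} {a b ε : ℝ} (hεa : ε < a)
    (h : ∃ᶠ x in weakBallFilter 𝕜 X, ∃ f ∈ K, a ≤ RCLike.re (f x) ∧ b ≤ RCLike.re (f y)) :
    ∃ f ∈ szlenkDeriv ε K, b ≤ RCLike.re (f y) := by
  choose! φ hφK hφa hφb using fun (x : X) (hx : ∃ f ∈ K, a ≤ RCLike.re (f x) ∧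
    b ≤ RCLike.re (f y)) => hx
  set S := {x : X | ∃ f ∈ K, a ≤ RCLike.re (f x) ∧ b ≤ RCLike.re (f y)}
  have hne : (weakBallFilter 𝕜 X ⊓ 𝓟 S).NeBot := frequently_mem_iff_neBot.1 h
  have hmem : ∀ᶠ x in weakBallFilter 𝕜 X ⊓ 𝓟 S, x ∈ S :=
    (eventually_principal.2 fun _ => id).filter_mono inf_le_right
  obtain ⟨f, hfK, hf⟩ := hK.exists_mapClusterPt_of_frequently
    (f := φ) (hmem.mono fun x hx => hφK x hx).frequently
  have hfb : b ≤ RCLike.re (f y) := by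
    by_contra! hlt
    have hev : ∀ᶠ g : WeakDual 𝕜 X in 𝓝 f, RCLike.re (g y) < b :=
      (RCLike.continuous_re.comp (WeakDual.eval_continuous y)).continuousAt.eventually_lt_const hlt
    obtain ⟨x, hxb, hx⟩ := ((hf.frequently hev).and_eventually hmem).exists
    exact (hφb x hx).not_gt hxb
  refine ⟨f, ⟨hfK, fun hε V hV => ?_⟩, hfb⟩
  -- The fixed functional `f` is small on weakly null `x`, while `φ x` is at least `a` there; hence
  -- `φ x` and `f` are more than `ε` apart.
  have hsmall : ∀ᶠ x in weakBallFilter 𝕜 X ⊓ 𝓟 S, ‖x‖ ≤ 1 ∧ ‖f x‖ < a - ε ∧ x ∈ S := by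
    refine (eventually_norm_le_weakBallFilter.filter_mono inf_le_left).and (.and ?_ hmem)
    have := ((tendsto_apply_weakBallFilter (WeakDual.toStrongDual f)).norm).eventually
      (gt_mem_nhds (by simpa using hεa : ‖(0 : 𝕜)‖ < a - ε))
    exact this.filter_mono inf_le_left
  obtain ⟨x, hxV, hx1, hfx, hxS⟩ := ((hf.frequently hV).and_eventually hsmall).exists
  have hlt : ε < ‖WeakDual.toStrongDual (φ x) - WeakDual.toStrongDual f‖ := by
    have h1 : ‖φ x x - f x‖ ≤ ‖WeakDual.toStrongDual (φ x) - WeakDual.toStrongDual f‖ :=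
      (WeakDual.toStrongDual (φ x) - WeakDual.toStrongDual f).unit_le_opNorm x hx1
    have h2 := RCLike.re_le_norm (φ x x - f x)
    have h3 := RCLike.re_le_norm (f x)
    have h4 := hφa x hxS
    rw [map_sub] at h2
    linarith
  calc ENNReal.ofReal ε
      < ENNReal.ofReal ‖WeakDual.toStrongDual (φ x) - WeakDual.toStrongDual f‖ :=
        (ENNReal.ofReal_lt_ofReal_iff (hε.trans hlt)).2 hlt
    _ = edist (WeakDual.toStrongDual (φ x)) (WeakDual.toStrongDual f) := by
        rw [edist_dist, dist_eq_norm]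
    _ ≤ Metric.ediam (WeakDual.toStrongDual '' (V ∩ K)) :=
        Metric.edist_le_ediam_of_mem (Set.mem_image_of_mem _ ⟨hxV, hφK x hxS⟩)
          (Set.mem_image_of_mem _ ⟨mem_of_mem_nhds hV, hfK⟩)

theorem Filter.Frequently.exists_frequently_of_finite {α ι : Type*} {F : Filter α} {G : Set ι}
    (hG : G.Finite) {p : ι → α → Prop} (h : ∃ᶠ x in F, ∃ i ∈ G, p i x) :
    ∃ i ∈ G, ∃ᶠ x in F, p i x := by
  by_contra! hc
  exact h (((eventually_all_finite hG).2 fun i hi => hc i hi).mono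
    fun x hx ⟨i, hi, hp⟩ => hx i hi hp)

theorem exists_finite_floor (R : ℝ) {δ : ℝ} (hδ : 0 < δ) :
    ∃ A : Set ℝ, A.Finite ∧ ∀ r : ℝ, |r| ≤ R → ∃ a ∈ A, a ≤ r ∧ r < a + δ := by
  refine ⟨(fun k : ℤ => k * δ) '' Set.Icc ⌊-R / δ⌋ ⌊R / δ⌋, (Set.finite_Icc _ _).image _,
    fun r hr => ⟨_, ⟨⌊r / δ⌋, ⟨?_, ?_⟩, rfl⟩, ?_, ?_⟩⟩
  · exact Int.floor_le_floor (div_le_div_of_nonneg_right (abs_le.1 hr).1 hδ.le)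
  · exact Int.floor_le_floor (div_le_div_of_nonneg_right (abs_le.1 hr).2 hδ.le)
  · exact (le_div_iff₀ hδ).1 (Int.floor_le _)
  · have := (div_lt_iff₀ hδ).1 (Int.lt_floor_add_one (r / δ))
    linarith

/-- If `K` is norming on many branches, then an iterated derived set of `K` is nonempty. -/
theorem exists_mem_szlenkDerivList_of_frequently [CompleteSpace X] {K : Set (WeakDual 𝕜 X)}
    (hK : IsCompact K) {δ : ℝ} (hδ : 0 < δ) (n : ℕ) :
    ∃ G : Set (List ℝ), G.Finite ∧ ∀ (c : ℝ) (y : X),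
      ¬ EventuallyTree (weakBallFilter 𝕜 X) n
        (fun l => ¬ ∃ f ∈ K, c ≤ RCLike.re (f (y + l.sum))) →
      ∃ l ∈ G, ∃ f ∈ szlenkDerivList l K, c ≤ RCLike.re (f y) + l.sum + n * (2 * δ) := by
  induction n with
  | zero =>
    refine ⟨{[]}, Set.finite_singleton _, fun c y h => ⟨[], rfl, ?_⟩⟩
    simpa [EventuallyTree, szlenkDerivList] using h
  | succ n ih =>
    obtain ⟨G, hG, hGn⟩ := ih
    obtain ⟨R, hR0, hR⟩ := exists_norm_apply_le_of_isCompact hK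
    obtain ⟨A, hA, hAR⟩ := exists_finite_floor R hδ
    -- Finiteness of `G`, uniform in `c` and `y`, lets one pair `(a, l)` serve for frequently many
    -- `x`. Each level loses `2δ`: rounding `Re f(x)` down to `a`, then lowering `a` to `a - δ`.
    refine ⟨Set.image2 (fun a l => (a - δ) :: l) A G, hA.image2 _ hG, fun c y h => ?_⟩
    have h1 : ∃ᶠ x in weakBallFilter 𝕜 X, ∃ p ∈ A ×ˢ G, ∃ f ∈ szlenkDerivList p.2 K,
        p.1 ≤ RCLike.re (f x) ∧
          c - p.1 - δ - p.2.sum - n * (2 * δ) ≤ RCLike.re (f y) := by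
      have h0 : ∃ᶠ x in weakBallFilter 𝕜 X, ¬ EventuallyTree (weakBallFilter 𝕜 X) n
          (fun l => ¬ ∃ f ∈ K, c ≤ RCLike.re (f (y + (x :: l).sum))) :=
        fun h' => h (Eventually.mono h' fun x hx => not_not.1 hx)
      refine (h0.and_eventually eventually_norm_le_weakBallFilter).mono fun x hx => ?_
      obtain ⟨l, hl, f, hf, hc⟩ := hGn c (y + x) (by simpa [add_assoc] using hx.1)
      have hfx : |RCLike.re (f x)| ≤ R :=
        (RCLike.abs_re_le_norm _).trans <| (hR f (szlenkDerivList_subset l K hf) x).trans <|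
          mul_le_of_le_one_right hR0 hx.2
      obtain ⟨a, ha, hax, hxa⟩ := hAR _ hfx
      refine ⟨(a, l), ⟨ha, hl⟩, f, hf, hax, ?_⟩
      rw [map_add, map_add] at hc
      dsimp only
      linarith
    obtain ⟨⟨a, l⟩, ⟨ha, hl⟩, h2⟩ := h1.exists_frequently_of_finite (hA.prod hG)
    have hKl : IsCompact (szlenkDerivList l K) :=
      hK.of_isClosed_subset (hK.isClosed.szlenkDerivList l) (szlenkDerivList_subset l K)
    obtain ⟨f, hf, hfy⟩ := exists_mem_szlenkDeriv_of_frequently hKl (sub_lt_self a hδ) h2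
    refine ⟨_, ⟨a, ha, l, hl, rfl⟩, f, hf, ?_⟩
    push_cast [List.sum_cons]
    dsimp only at hfy
    linarith

theorem HasSummableSzlenkIndexWith.eventuallyTree [CompleteSpace X] {K : Set (WeakDual 𝕜 X)}
    (hK : IsCompact K) {M : ℝ} (hM : 0 ≤ M) (h : HasSummableSzlenkIndexWith M K) (n : ℕ) :
    EventuallyTree (weakBallFilter 𝕜 X) n fun l => supportFun K l.sum ≤ M + 1 := by
  by_contra hc
  -- The total loss `n * 2δ` is then below `1`, the slack in `M + 1`.
  have hδ : (0 : ℝ) < 1 / (4 * (n + 1)) := by positivity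
  obtain ⟨G, -, hG⟩ := exists_mem_szlenkDerivList_of_frequently hK hδ n
  obtain ⟨l, -, f, hf, hle⟩ := hG (M + 1) 0 fun h' => hc <| h'.mono fun l hl =>
    supportFun_le (by linarith) fun f hf => le_of_not_ge fun hfl => hl ⟨f, hf, by simpa using hfl⟩
  have h1 := h l ⟨f, hf⟩
  have h2 : n * (2 * (1 / (4 * (n + 1)))) < (1 : ℝ) := by
    rw [show n * (2 * (1 / (4 * (n + 1 : ℝ)))) = n / (2 * (n + 1)) by field_simp; norm_num,
      div_lt_one (by positivity)]
    linarith [(n.cast_nonneg : (0 : ℝ) ≤ n)]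
  simp at hle
  simp at h2
  linarith

/-! ### From derived sets to large branches. -/

/-- Points of iterated derived sets yield branches on which `K` is large. -/
theorem not_eventuallyTree_of_mem_szlenkDerivList {K : Set (WeakDual 𝕜 X)} (l : List ℝ)
    {δ : ℝ} (hδ : 0 < δ) {f : WeakDual 𝕜 X} (hf : f ∈ szlenkDerivList l K) (y : X) :
    ¬ EventuallyTree (weakBallFilter 𝕜 X) l.length fun t => ∀ g ∈ K,
      RCLike.re (g (y + t.sum)) ≤ RCLike.re (f y) + l.sum / 4 - δ := by
  induction l generalizing f y δ with
  | nil =>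
    intro h
    have := h f hf
    simp at this
    linarith
  | cons ε l ih =>
    intro h
    obtain hε | hε := le_or_gt ε 0
    · have h0 := zero_mem_of_mem_weakBallFilter h
      refine ih hδ hf.1 y (EventuallyTree.mono h0 fun t ht g hg => ?_)
      have := ht g hg
      simp only [List.sum_cons, zero_add] at this
      linarith
    -- The errors at `y`, at `a` (halved) and in `f z` total `5η/2`, less than the `δ/2` given up at
    -- this level.
    set η := δ / 6 with hη
    have hη0 : 0 < η := by positivity
    have hfU := ((tendsto_apply_weakBallFilter (WeakDual.toStrongDual f)).norm).eventually
      (gt_mem_nhds (by simpa using hη0 : ‖(0 : 𝕜)‖ < η))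
    obtain ⟨A, hA, hAU⟩ := exists_finite_half_sub_mem (inter_mem h hfU)
    have hev : ∀ z : X, ∀ᶠ g in 𝓝 f, ‖g z - f z‖ < η := fun z => by
      have := ((WeakDual.eval_continuous (𝕜 := 𝕜) z).tendsto f).eventually
        (Metric.ball_mem_nhds (f z) hη0)
      simpa [dist_eq_norm] using this
    have hV : {g : WeakDual 𝕜 X | ‖g y - f y‖ < η ∧ ∀ a ∈ A, ‖g a - f a‖ < η} ∈ 𝓝 f :=
      (hev y).and ((eventually_all_finite hA).2 fun a _ => hev a)
    have hdiam := hf.2 hε _ hV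
    -- Diameter above `ε` only gives distance above `ε/2` from `f`; passing to `(x - a)/2` halves
    -- this again, whence the `1/4`.
    obtain ⟨g, hg, hgf⟩ : ∃ g : WeakDual 𝕜 X, (g ∈ szlenkDerivList l K ∧
        ‖g y - f y‖ < η ∧ ∀ a ∈ A, ‖g a - f a‖ < η) ∧
        ε / 2 < ‖WeakDual.toStrongDual g - WeakDual.toStrongDual f‖ := by
      by_contra! hc
      refine hdiam.not_ge (Metric.ediam_le ?_)
      rintro _ ⟨g₁, hg₁, rfl⟩ _ ⟨g₂, hg₂, rfl⟩
      rw [edist_dist]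
      refine ENNReal.ofReal_le_ofReal ?_
      have h1 := hc g₁ ⟨hg₁.2, hg₁.1⟩
      have h2 := hc g₂ ⟨hg₂.2, hg₂.1⟩
      have h3 := dist_triangle_right (WeakDual.toStrongDual g₁) (WeakDual.toStrongDual g₂)
        (WeakDual.toStrongDual f)
      rw [dist_eq_norm _ (WeakDual.toStrongDual f), dist_eq_norm _ (WeakDual.toStrongDual f)] at h3
      linarith
    obtain ⟨x, hx1, hx⟩ : ∃ x : X, ‖x‖ ≤ 1 ∧ ε / 2 < RCLike.re (g x - f x) := by
      by_contra! hc
      refine hgf.not_ge (ContinuousLinearMap.opNorm_le_of_unit_norm (by positivity) fun x hx => ?_)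
      obtain ⟨c, hc1, hcx⟩ := RCLike.exists_norm_eq_mul_self (g x - f x)
      have h1 := hc (c • x) (by rw [norm_smul, hc1, hx, one_mul])
      rw [map_smul, map_smul, ← smul_sub, smul_eq_mul, ← hcx, RCLike.ofReal_re] at h1
      exact h1
    obtain ⟨a, ha, hU, hfx⟩ := hAU x hx1
    set z : X := (2⁻¹ : 𝕜) • (x - a) with hz
    have hre : RCLike.re (g z - f z) = (RCLike.re (g x - f x) - RCLike.re (g a - f a)) / 2 := by
      have h2 : (2⁻¹ : 𝕜) = ((2⁻¹ : ℝ) : 𝕜) := by push_cast; rfl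
      rw [hz, map_smul, map_smul, ← smul_sub, smul_eq_mul, h2, RCLike.re_ofReal_mul, map_sub g,
        map_sub f, sub_sub_sub_comm, map_sub RCLike.re (g x - f x)]
      ring
    have e1 := (abs_le.1 ((RCLike.abs_re_le_norm _).trans (hg.2.2 a ha).le)).2
    have e2 := (abs_le.1 ((RCLike.abs_re_le_norm _).trans hg.2.1.le)).1
    have e3 := (abs_le.1 ((RCLike.abs_re_le_norm _).trans (le_of_lt hfx))).1
    have e3' : -η ≤ RCLike.re (f z) := e3
    rw [map_sub] at e2 hre
    refine ih (half_pos hδ) hg.1 (y + z) (EventuallyTree.mono hU fun t ht g' hg' => ?_)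
    have := ht g' hg'
    rw [List.sum_cons, ← add_assoc] at this
    rw [map_add g, map_add RCLike.re]
    rw [List.sum_cons] at this
    linarith

end Szlenk

/-! ### Weakly null trees and iterated quantifiers. -/

section Trees

variable {𝕜 : Type w} [RCLike 𝕜] {X : Type u} [NormedAddCommGroup X] [NormedSpace 𝕜 X]

theorem IsWeaklyNullTree.tail {D : Type v} [Preorder D] {n : ℕ} {x : List D → X}
    (h : IsWeaklyNullTree 𝕜 (n + 1) x) (u : D) :
    IsWeaklyNullTree 𝕜 n fun t => x (u :: t) where
  norm_le_one t _ h2 := h.norm_le_one _ (by simp) (by simpa using h2)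
  weakly_null t ht := h.weakly_null (u :: t) (by simpa using ht)

/-- Each net of successors converges along the weak filter, so a good successor can be chosen at
every node. -/
theorem EventuallyTree.exists_branch {D : Type v} [Preorder D] [IsDirectedOrder D] [Nonempty D]
    {n : ℕ} {x : List D → X} (hx : IsWeaklyNullTree 𝕜 n x) {P : List X → Prop}
    (hP : EventuallyTree (weakBallFilter 𝕜 X) n P) :
    ∃ t : List D, t.length = n ∧ P (branchValues x t) := by
  induction n generalizing x P with
  | zero => exact ⟨[], rfl, hP⟩
  | succ n ih =>
    have ht : Tendsto (fun u : D => x [u]) atTop (weakBallFilter 𝕜 X) :=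
      tendsto_weakBallFilter_iff.2 ⟨hx.weakly_null [] (by simp),
        Eventually.of_forall fun u => hx.norm_le_one [u] (by simp) (by simp)⟩
    obtain ⟨u, hu⟩ := (ht.eventually hP).exists
    obtain ⟨t, rfl, h⟩ := ih (hx.tail u) hu
    exact ⟨u :: t, rfl, h⟩

/-- Needed for `ciInf_le`: a real infimum over a set unbounded below is `0` by convention. -/
theorem bddBelow_supportFun_branchSum [CompleteSpace X] {K : Set (WeakDual 𝕜 X)}
    (hK : IsCompact K) {D : Type v} [Preorder D] {n : ℕ} {x : List D → X}
    (hx : IsWeaklyNullTree 𝕜 n x) :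
    BddBelow (Set.range fun t : Fin n → D => supportFun K (branchSum x t)) := by
  obtain rfl | ⟨f, hf⟩ := K.eq_empty_or_nonempty
  · exact ⟨0, by rintro _ ⟨t, rfl⟩; simp [supportFun]⟩
  obtain ⟨R, hR0, hR⟩ := exists_norm_apply_le_of_isCompact hK
  refine ⟨-(R * n), ?_⟩
  rintro _ ⟨t, rfl⟩
  have h1 : ‖branchSum x t‖ ≤ n := by
    refine (norm_sum_le_of_le _ (f := fun i => x ((List.ofFn t).take i)) (n := fun _ => 1)
      fun i hi => ?_).trans (by simp)
    rw [Finset.mem_Icc] at hi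
    exact hx.norm_le_one _ (by simp; omega) (by simp)
  have h2 := re_apply_le_supportFun hK hf (branchSum x t)
  have h3 := (abs_le.1 ((RCLike.abs_re_le_norm _).trans (hR f hf (branchSum x t)))).1
  have h4 := mul_le_mul_of_nonneg_left h1 hR0
  dsimp only
  linarith

theorem EventuallyTree.treeBound [CompleteSpace X] {K : Set (WeakDual 𝕜 X)} (hK : IsCompact K)
    {n : ℕ} {s : ℝ}
    (h : EventuallyTree (weakBallFilter 𝕜 X) n fun l => supportFun K l.sum ≤ s) :
    TreeBound.{u, v} n K s := by
  intro D _ _ _ x hx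
  obtain ⟨t, rfl, ht⟩ := h.exists_branch hx
  refine (ciInf_le (bddBelow_supportFun_branchSum hK hx) t.get).trans ?_
  rwa [branchSum_eq_sum_branchValues, List.ofFn_get]

/-- If a property fails along many branches, then it fails along all branches of some weakly null
tree. -/
theorem exists_tree_of_not_eventuallyTree {D : Type v} [Preorder D] [IsDirectedOrder D]
    (U : D → Set X) (hU : ∀ d, U d ∈ weakBallFilter 𝕜 X)
    (hD : ∀ V ∈ weakBallFilter 𝕜 X, ∀ᶠ d in atTop, U d ⊆ V) (n : ℕ) (P : List X → Prop)
    (hP : ¬ EventuallyTree (weakBallFilter 𝕜 X) n P) :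
    ∃ x : List D → X, IsWeaklyNullTree 𝕜 n x ∧
      ∀ t : List D, t.length = n → ¬ P (branchValues x t) := by
  induction n generalizing P with
  | zero =>
    refine ⟨fun _ => 0, ⟨fun t _ _ => by simp, fun t ht => by simp at ht⟩, fun t ht => ?_⟩
    rw [List.length_eq_zero_iff.1 ht]
    exact hP
  | succ n ih =>
    have hP' : ∃ᶠ y in weakBallFilter 𝕜 X,
        ¬ EventuallyTree (weakBallFilter 𝕜 X) n fun l => P (y :: l) :=
      fun h => hP (Eventually.mono h fun y hy => not_not.1 hy)
    choose y hyP hyU using fun d : D => (hP'.and_eventually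
      (Filter.inter_mem (hU d) (eventually_norm_le_weakBallFilter (𝕜 := 𝕜)))).exists
    choose x hx hxP using fun d : D => ih _ (hyP d)
    have hy : Tendsto y atTop (weakBallFilter 𝕜 X) := fun V hV =>
      (hD V hV).mono fun d hd => hd (hyU d).1
    -- The root's successors are `y u`, and the tree `x u` is grafted above `y u`; its value at `[]`
    -- is discarded.
    let z : List D → X
      | [] => 0
      | [u] => y u
      | u :: v :: t => x u (v :: t)
    have hz : ∀ (u : D) (t : List D), t ≠ [] → z (u :: t) = x u t := by
      rintro u (_ | ⟨v, t⟩) ht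
      · exact absurd rfl ht
      · rfl
    refine ⟨z, ⟨?_, ?_⟩, ?_⟩
    · rintro (_ | ⟨u, _ | ⟨v, t⟩⟩) h1 h2
      · simp at h1
      · exact (hyU u).2
      · exact (hx u).norm_le_one _ (by simp) (by simpa using h2)
    · rintro (_ | ⟨u, t⟩) ht f
      · exact (tendsto_apply_weakBallFilter f).comp hy
      · refine ((hx u).weakly_null t (by simpa using ht) f).congr fun v => ?_
        rw [List.cons_append, hz u _ (by simp)]
    · rintro (_ | ⟨u, t⟩) ht
      · simp at ht
      · have hb : ∀ (w₁ w₂ : List D → X) (t : List D), (∀ s, s ≠ [] → w₁ s = w₂ s) →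
            branchValues w₁ t = branchValues w₂ t := by
          intro w₁ w₂ t h
          induction t generalizing w₁ w₂ with
          | nil => rfl
          | cons a t iht =>
            rw [branchValues, branchValues, h [a] (by simp), iht _ _ fun s _ => h _ (by simp)]
        rw [branchValues, hb _ (x u) t fun s hs => hz u s hs]
        exact hxP u t (by simpa using ht)

theorem TreeBound.eventuallyTree {K : Set (WeakDual 𝕜 X)} {n : ℕ} {s s' : ℝ}
    (h : TreeBound.{u, v} n K s) (hs : s < s') :
    EventuallyTree (weakBallFilter 𝕜 X) n fun l => supportFun K l.sum ≤ s' := by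
  by_contra hc
  -- The members of the filter under reverse inclusion: choosing a point in each yields a weakly
  -- null net.
  let D : Type (max u v) := ULift.{v} {U : Set X // U ∈ weakBallFilter 𝕜 X}ᵒᵈ
  let U : D → Set X := fun d => (OrderDual.ofDual d.down).1
  have : Nonempty D := ⟨⟨OrderDual.toDual ⟨_, univ_mem⟩⟩⟩
  have : IsDirectedOrder D := ⟨fun a b =>
    ⟨⟨OrderDual.toDual ⟨U a ∩ U b, inter_mem (OrderDual.ofDual a.down).2
      (OrderDual.ofDual b.down).2⟩⟩, Set.inter_subset_left, Set.inter_subset_right⟩⟩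
  obtain ⟨x, hx, hxP⟩ := exists_tree_of_not_eventuallyTree (𝕜 := 𝕜) (D := D) U
    (fun d => (OrderDual.ofDual d.down).2)
    (fun V hV => (eventually_ge_atTop (⟨OrderDual.toDual ⟨V, hV⟩⟩ : D)).mono fun d hd => hd) n _ hc
  refine hs.not_ge ((le_ciInf fun t => ?_).trans (h D x hx))
  rw [branchSum_eq_sum_branchValues]
  exact (not_le.1 (hxP _ (List.length_ofFn))).le

/-! ### Passage to the absolutely convex hull. -/

open scoped ComplexOrder in
theorem absConvex_norm_apply_le (z : X) (c : ℝ) :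
    AbsConvex 𝕜 {g : WeakDual 𝕜 X | ‖g z‖ ≤ c} := by
  refine ⟨balanced_iff_smul_mem.2 fun {a} ha g hg => ?_, fun g hg g' hg' a b ha hb hab => ?_⟩
  · change ‖a * g z‖ ≤ c
    rw [norm_mul]
    exact (mul_le_of_le_one_left (norm_nonneg _) ha).trans hg
  · change ‖a * g z + b * g' z‖ ≤ c
    refine (norm_add_le _ _).trans ?_
    rw [norm_mul, norm_mul]
    have h1 : ‖a‖ + ‖b‖ = 1 := by
      rw [← RCLike.ofReal_inj (K := 𝕜), RCLike.ofReal_add, RCLike.norm_of_nonneg' ha,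
        RCLike.norm_of_nonneg' hb, hab, RCLike.ofReal_one]
    calc ‖a‖ * ‖g z‖ + ‖b‖ * ‖g' z‖ ≤ ‖a‖ * c + ‖b‖ * c :=
          add_le_add (mul_le_mul_of_nonneg_left hg (norm_nonneg a))
            (mul_le_mul_of_nonneg_left hg' (norm_nonneg b))
      _ = c := by rw [← add_mul, h1, one_mul]

open scoped ComplexOrder in
theorem norm_apply_le_of_mem_weakStarClosedAbsConvexHull {K : Set (WeakDual 𝕜 X)} {z : X} {c : ℝ}
    (h : ∀ f ∈ K, ‖f z‖ ≤ c) {g : WeakDual 𝕜 X} (hg : g ∈ weakStarClosedAbsConvexHull K) :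
    ‖g z‖ ≤ c :=
  closedAbsConvexHull_min (t := {g : WeakDual 𝕜 X | ‖g z‖ ≤ c}) h (absConvex_norm_apply_le z c)
    (isClosed_le (WeakDual.eval_continuous z).norm continuous_const) hg

open scoped ComplexOrder in
theorem subset_weakStarClosedAbsConvexHull (K : Set (WeakDual 𝕜 X)) :
    K ⊆ weakStarClosedAbsConvexHull K := subset_closedAbsConvexHull

/-- The filter is stable under multiplication by `±1` and `±I`, so real and imaginary parts are each
bounded by `s` in absolute value. -/
theorem EventuallyTree.norm_apply_sum_le {K : Set (WeakDual 𝕜 X)} (hK : IsCompact K) {n : ℕ}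
    {s : ℝ} (h : EventuallyTree (weakBallFilter 𝕜 X) n fun l => supportFun K l.sum ≤ s) :
    EventuallyTree (weakBallFilter 𝕜 X) n fun l => ∀ f ∈ K, ‖f l.sum‖ ≤ 2 * s := by
  have hθ : ∀ θ : 𝕜, ‖θ‖ ≤ 1 → EventuallyTree (weakBallFilter 𝕜 X) n
      fun l => ∀ f ∈ K, RCLike.re (θ * f l.sum) ≤ s := fun θ hθ =>
    (h.map (tendsto_smul_weakBallFilter hθ)).mono fun l hl f hf => by
      rw [← smul_eq_mul, ← map_smul, List.smul_sum]
      exact (re_apply_le_supportFun hK hf _).trans hl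
  have hI : ‖(RCLike.I : 𝕜)‖ ≤ 1 := by
    rw [RCLike.norm_I]
    split_ifs <;> simp
  refine (((hθ 1 (by simp)).and (hθ (-1) (by simp))).and ((hθ RCLike.I hI).and
    (hθ (-RCLike.I) (by simpa using hI)))).mono fun l hl f hf => ?_
  obtain ⟨⟨h1, h2⟩, h3, h4⟩ := hl
  have h1 := h1 f hf
  have h2 := h2 f hf
  have h3 := h3 f hf
  have h4 := h4 f hf
  simp only [one_mul, neg_mul, map_neg, RCLike.I_mul_re] at h1 h2 h3 h4
  have : ‖f l.sum‖ ≤ |RCLike.re (f l.sum)| + |RCLike.im (f l.sum)| := by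
    conv_lhs => rw [← RCLike.re_add_im (f l.sum)]
    refine (norm_add_le _ _).trans ?_
    rw [norm_mul, RCLike.norm_ofReal, RCLike.norm_ofReal]
    gcongr
    exact mul_le_of_le_one_right (abs_nonneg _) hI
  have := abs_le'.2 ⟨h1, h2⟩
  have : |RCLike.im (f l.sum)| ≤ s := abs_le'.2 ⟨by linarith, h3⟩
  linarith

theorem hasSummableSzlenkIndex_weakStarClosedAbsConvexHull {K : Set (WeakDual 𝕜 X)}
    (hK : IsCompact K) {s : ℝ} (hs : 0 ≤ s)
    (h : ∀ n, 1 ≤ n → EventuallyTree (weakBallFilter 𝕜 X) n fun l => supportFun K l.sum ≤ s) :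
    HasSummableSzlenkIndex (weakStarClosedAbsConvexHull K) := by
  refine ⟨8 * s, by positivity, fun l ⟨f, hf⟩ => ?_⟩
  obtain rfl | hl := eq_or_ne l []
  · simpa using hs
  by_contra! hlt
  -- At `y = 0` this `δ` turns the threshold into exactly `2s`; it is positive because the sum
  -- exceeds `8s`.
  refine not_eventuallyTree_of_mem_szlenkDerivList l (δ := l.sum / 4 - 2 * s) (by linarith) hf 0
    (((h l.length (List.length_pos_iff.2 hl)).norm_apply_sum_le hK).mono fun t ht g hg => ?_)
  have h1 := (RCLike.re_le_norm _).trans (norm_apply_le_of_mem_weakStarClosedAbsConvexHull ht hg)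
  simpa using h1

/-! ### Finiteness of `Σ(K)` and the equivalence. -/

theorem szlenkSigma_lt_top_of_hasSummableSzlenkIndex [CompleteSpace X] {K : Set (WeakDual 𝕜 X)}
    (hK : IsCompact K) (h : HasSummableSzlenkIndex K) : szlenkSigma.{u, v} K < ⊤ := by
  obtain ⟨M, hM0, hM⟩ := h
  have hle : szlenkSigma.{u, v} K ≤ ENNReal.ofReal (M + 1) := iSup₂_le fun n _ =>
    sInf_le ⟨M + 1, by positivity, (hM.eventuallyTree hK hM0 n).treeBound hK, rfl⟩
  exact hle.trans_lt ENNReal.ofReal_lt_top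

theorem exists_eventuallyTree_of_szlenkSigma_lt_top {K : Set (WeakDual 𝕜 X)}
    (h : szlenkSigma.{u, v} K < ⊤) : ∃ s : ℝ, 0 ≤ s ∧ ∀ n, 1 ≤ n →
      EventuallyTree (weakBallFilter 𝕜 X) n fun l => supportFun K l.sum ≤ s := by
  refine ⟨(szlenkSigma.{u, v} K).toReal + 1, by positivity, fun n hn => ?_⟩
  have h1 : szlenkSigmaN.{u, v} n K < ENNReal.ofReal ((szlenkSigma.{u, v} K).toReal + 1) := by
    have hle : szlenkSigmaN.{u, v} n K ≤ szlenkSigma.{u, v} K :=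
      le_iSup₂ (f := fun n (_ : 1 ≤ n) => szlenkSigmaN.{u, v} n K) n hn
    exact hle.trans_lt ((ENNReal.lt_ofReal_iff_toReal_lt h.ne).2 (lt_add_one _))
  obtain ⟨_, ⟨s, hs, hb, rfl⟩, hlt⟩ := sInf_lt_iff.1 h1
  exact hb.eventuallyTree ((ENNReal.ofReal_lt_ofReal_iff (by positivity)).1 hlt)

end Trees

theorem mainTheorem1 {𝕜 : Type w} [RCLike 𝕜] {X : Type u} [NormedAddCommGroup X]
    [NormedSpace 𝕜 X] [CompleteSpace X] (K : Set (WeakDual 𝕜 X)) (hK : IsCompact K) :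
    [HasSummableSzlenkIndex K,
      szlenkSigma.{u, v} K < ⊤,
      HasSummableSzlenkIndex (weakStarClosedAbsConvexHull K)].TFAE := by
  tfae_have 1 → 2 := szlenkSigma_lt_top_of_hasSummableSzlenkIndex hK
  tfae_have 2 → 3 := fun h =>
    let ⟨_, hs, hsn⟩ := exists_eventuallyTree_of_szlenkSigma_lt_top h
    hasSummableSzlenkIndex_weakStarClosedAbsConvexHull hK hs hsn
  tfae_have 3 → 1 := fun h => h.mono (subset_weakStarClosedAbsConvexHull K)
  tfae_finish
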